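/- Let $[N]=\{1,\dots,N\}$ and let $\Delta([N])$ be the set of probability distributions on $[N]$. A distribution is flat if it is uniform on its support. Fix a real constant $K>2$ and put $$\Pi_{\mathsf{Yes}}=\{\mathcal D\in\Delta([N]) : \mathcal D\text{ is flat},\ |\mathrm{supp}\,\mathcal D|=\lfloor N^{2/3}/K\rfloor\},\qquad \Pi_{\mathsf{No}}=\{\mathcal D\in\Delta([N]) : \mathcal D\text{ is flat},\ |\mathrm{supp}\,\mathcal D|=\lfloor N^{2/3}\rfloor\}.$$ A $\mathsf{PCond}$ oracle for $\mathcal D$ takes a set $S\subseteq[N]$ with $|S|\in\{2,N\}$ and returns a fresh element $x\in S$ with probability $\mathcal D(x)/\mathcal D(S)$ if $\mathcal D(S)>0$, and the symbol $\mathsf{FAIL}$ if $\mathcal D(S)=0$. A tester is a randomized algorithm that queries this oracle adaptively and answers $\mathsf{Yes}$ or $\mathsf{No}$; every oracle call (a pair, or the whole domain, i.e. a plain sample) counts as one query. Both $\Pi_{\mathsf{Yes}}$ and $\Pi_{\mathsf{No}}$ are label-invariant, that is, closed under permutations of $[N]$. Moreover, there are $c>0$ and $N_0$, depending only on $K$,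 such that for every $N\ge N_0$: 1. (Promise problem) If a tester answers $\mathsf{Yes}$ with probability at least $0.99$ on every $\mathcal D\in\Pi_{\mathsf{Yes}}$ and $\mathsf{No}$ with probability at least $0.99$ on every $\mathcal D\in\Pi_{\mathsf{No}}$, and on each $\mathcal D\in\Pi_{\mathsf{Yes}}\cup\Pi_{\mathsf{No}}$ it never makes more than $q$ queries, then $q\ge c\,N^{1/3}$. 2. (Property testing) Let $0<\tau\le 1/2$. If a tester answers $\mathsf{Yes}$ with probability at least $0.99$ on every $\mathcal D\in\Pi_{\mathsf{Yes}}$ and $\mathsf{No}$ with probability at least $0.99$ on every $\mathcal D\in\Delta([N])$ with $d_{\mathrm{TV}}(\mathcal D,\Pi_{\mathsf{Yes}})=\min_{\mathcal D'\in\Pi_{\mathsf{Yes}}}d_{\mathrm{TV}}(\mathcal D,\mathcal D')>\tau$, and on each $\mathcal D\in\Pi_{\mathsf{Yes}}\cup\Pi_{\mathsf{No}}$ it never makes more than $q$ queries, then $q\ge c\,N^{1/3}$. -/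

import Mathlib

open scoped Classical in
/-- The answer of a conditional sampling oracle for `D` to the query `S`: if `D(S) > 0`, an element
`x ∈ S` drawn with probability `D x / D(S)`; if `D(S) = 0`, the symbol `FAIL`, written `none`. -/
noncomputable def condOracle {N : ℕ} (D : PMF (Fin N)) (S : Finset (Fin N)) :
    PMF (Option (Fin N)) :=
  if h : ∃ x ∈ (S : Set (Fin N)), x ∈ D.support then (D.filter S h).map some else PMF.pure none

/-- Randomized adaptive algorithms over the domain `[N]` that have access to a pairwise conditional
sampling oracle and answer `Yes` (`true`) or `No` (`false`). Such an algorithm can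
* stop with an answer,
* draw internal randomness (from any discrete distribution, free of charge), or
* query the oracle on a set of size exactly two, or on the whole domain (a plain sample), and go on
  depending on the oracle's answer. -/
inductive PCondTester (N : ℕ) : Type
  | output (answer : Bool) : PCondTester N
  | coin (μ : PMF ℕ) (next : ℕ → PCondTester N) : PCondTester N
  | query (S : Finset (Fin N)) (hS : S.card = 2 ∨ S.card = N)
      (next : Option (Fin N) → PCondTester N) : PCondTester N

namespace PCondTester

/-- The distribution of the answer of the algorithm when the oracle belongs to `D`. -/
noncomputable def run {N : ℕ} (D : PMF (Fin N)) : PCondTester N → PMF Bool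
  | output b => PMF.pure b
  | coin μ next => μ.bind fun i => run D (next i)
  | query S _ next => (condOracle D S).bind fun a => run D (next a)

/-- With the oracle of `D`, the algorithm never (that is, with no internal randomness and oracle
answers that have positive probability) makes more than `q` oracle queries. Samples and pair
queries both count. -/
def MakesAtMost {N : ℕ} (D : PMF (Fin N)) : PCondTester N → ℕ → Prop
  | output _, _ => True
  | coin μ next, q => ∀ i ∈ μ.support, MakesAtMost D (next i) q
  | query _ _ _, 0 => False
  | query S _ next, q + 1 => ∀ a ∈ (condOracle D S).support, MakesAtMost D (next a) q

end PCondTester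

/-- A property: a set of distributions over `[N]`. It is label-invariant if it is closed under
relabelling the domain. -/
def LabelInvariant {N : ℕ} (P : Set (PMF (Fin N))) : Prop :=
  ∀ D ∈ P, ∀ π : Equiv.Perm (Fin N), D.map π ∈ P

/-- A flat distribution: uniform on its support. -/
def IsFlat {N : ℕ} (D : PMF (Fin N)) : Prop :=
  ∀ x ∈ D.support, ∀ y ∈ D.support, D x = D y

/-- The flat distributions over `[N]` with support of size `s`. -/
def flatWithSupportSize (N s : ℕ) : Set (PMF (Fin N)) :=
  {D | D.support.ncard = s ∧ IsFlat D}

/-- Flat distributions with support of size `N^{2/3} / K` (rounded down). -/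
noncomputable def hardYes (K : ℝ) (N : ℕ) : Set (PMF (Fin N)) :=
  flatWithSupportSize N ⌊(N : ℝ) ^ (2 / 3 : ℝ) / K⌋₊

/-- Flat distributions with support of size `N^{2/3}` (rounded down). -/
noncomputable def hardNo (N : ℕ) : Set (PMF (Fin N)) :=
  flatWithSupportSize N ⌊(N : ℝ) ^ (2 / 3 : ℝ)⌋₊

/-- Total variation distance. -/
noncomputable def tvDist {N : ℕ} (D D' : PMF (Fin N)) : ℝ :=
  (1 / 2) * ∑ x, |(D x).toReal - (D' x).toReal|

/-- Total variation distance of `D` to a (nonempty) property: the infimum of the distances to its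
members. -/
noncomputable def tvDistTo {N : ℕ} (D : PMF (Fin N)) (P : Set (PMF (Fin N))) : ℝ :=
  sInf (tvDist D '' P)

/-- `T` decides the promise problem `(PYes, PNo)` with failure probability `β`. -/
def IsPromiseTester {N : ℕ} (T : PCondTester N) (PYes PNo : Set (PMF (Fin N))) (β : ℝ) : Prop :=
  (∀ D ∈ PYes, 1 - β ≤ (T.run D true).toReal) ∧
  (∀ D ∈ PNo, 1 - β ≤ (T.run D false).toReal)

/-- `T` tests the property `P` with proximity parameter `τ` and failure probability `β`: it answers
`Yes` on the members of `P` and `No` on the distributions at distance more than `τ` from `P`. -/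
def IsPropertyTester {N : ℕ} (T : PCondTester N) (P : Set (PMF (Fin N))) (τ β : ℝ) : Prop :=
  (∀ D ∈ P, 1 - β ≤ (T.run D true).toReal) ∧
  (∀ D : PMF (Fin N), τ < tvDistTo D P → 1 - β ≤ (T.run D false).toReal)

/-! Take a flat distribution with a uniformly random support `R` of size `s`. While samples never
repeat and pair queries never hit an unsampled element of `R`, the answers carry no information
about `s`: samples are uniform among untouched elements, and a pair query is answered from the
elements sampled so far. This is `idealRun`, which does not mention `s`.

A step of at most `m` leaves the ideal behaviour with probability at most `m / s` for a sample (a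
collision) and `2 * s / (N - 3 * m)` for a pair (a lucky hit). If both are at most `1 / (3 * m)`,
the total loss over `q ≤ m` steps is at most `1 / 3`. The induction `idealBound` carries this out by
counting the supports compatible with the transcript; a one-sided bound for each answer suffices.

A promise tester would thus give each answer with probability at most `0.01 + 1 / 3` in the same
ideal run, which is impossible. With `s` of order `N^{2/3}` both conditions allow `m` of order
`N^{1/3}`. Testing reduces to the promise problem because No instances are more than `1 / 2` away
from the Yes instances. -/

open Finset

/-! ### Oracle answers for uniform distributions -/

/-- The answer of a conditional sampling oracle for a uniform distribution whose support meets the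
query in `R`. -/
noncomputable def uniformAnswer {α : Type*} (R : Finset α) : PMF (Option α) :=
  if h : R.Nonempty then (PMF.uniformOfFinset R h).map some else PMF.pure none

theorem condOracle_uniformOfFinset {N : ℕ} (R S : Finset (Fin N)) (hR : R.Nonempty) :
    condOracle (PMF.uniformOfFinset R hR) S = uniformAnswer (S ∩ R) := by
  classical
  unfold condOracle uniformAnswer
  have hiff : (∃ x ∈ (S : Set (Fin N)), x ∈ (PMF.uniformOfFinset R hR).support) ↔
      (S ∩ R).Nonempty := by
    simp [Finset.Nonempty]
  by_cases h : (S ∩ R).Nonempty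
  · rw [dif_pos (hiff.2 h), dif_pos h]
    congr 1
    ext x
    have hsum : ∑' y, (S : Set (Fin N)).indicator (PMF.uniformOfFinset R hR) y
        = ((S ∩ R).card : ENNReal) * (R.card : ENNReal)⁻¹ := by
      rw [tsum_fintype, ← nsmul_eq_mul, ← Finset.sum_const, ← Finset.sum_filter_add_sum_filter_not
        univ (fun y => y ∈ S ∩ R)]
      rw [Finset.sum_eq_zero (s := filter (fun y => ¬ y ∈ S ∩ R) univ), add_zero]
      · refine Finset.sum_congr (by ext; simp) fun y hy => ?_
        rw [Finset.mem_inter] at hy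
        simp [hy.1, hy.2]
      · intro y hy
        by_cases hS : y ∈ S <;> by_cases hy' : y ∈ R <;> simp_all
    rw [PMF.filter_apply, hsum, PMF.uniformOfFinset_apply]
    have hR0 : (R.card : ENNReal) ≠ 0 := by simpa using hR.ne_empty
    by_cases hS : x ∈ S <;> by_cases hx : x ∈ R <;> simp [hS, hx]
    rw [ENNReal.mul_inv (by simp [hR.ne_empty]) (by simp), inv_inv, mul_comm, mul_assoc,
      ENNReal.mul_inv_cancel hR0 (by simp), mul_one]
  · rw [dif_neg (mt hiff.1 h), dif_neg h]

theorem uniformAnswer_bind_apply {α : Type*} [DecidableEq α] (R : Finset α) (hR : R.Nonempty)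
    (f : Option α → PMF Bool) (b : Bool) :
    ((uniformAnswer R).bind f) b = (R.card : ENNReal)⁻¹ * ∑ x ∈ R, f (some x) b := by
  rw [uniformAnswer, dif_pos hR, PMF.bind_map, PMF.bind_apply, tsum_eq_sum (s := R),
    Finset.mul_sum]
  · exact Finset.sum_congr rfl fun x hx => by simp [hx]
  · intro x hx
    rw [PMF.uniformOfFinset_apply_of_notMem hR hx, zero_mul]

theorem some_mem_support_uniformAnswer {α : Type*} {R : Finset α} {x : α} (hx : x ∈ R) :
    some x ∈ (uniformAnswer R).support := by
  rw [uniformAnswer, dif_pos ⟨x, hx⟩, PMF.support_map]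
  exact ⟨x, (PMF.mem_support_uniformOfFinset_iff _ _).2 hx, rfl⟩

/-! ### Counting the supports compatible with a transcript -/

/-- The sets of size `s` that contain `A` and avoid `B`. -/
def setsBetween {N : ℕ} (s : ℕ) (A B : Finset (Fin N)) : Finset (Finset (Fin N)) :=
  {R | R.card = s ∧ A ⊆ R ∧ Disjoint R B}

theorem mem_setsBetween {N s : ℕ} {A B R : Finset (Fin N)} :
    R ∈ setsBetween s A B ↔ R.card = s ∧ A ⊆ R ∧ Disjoint R B := by
  simp [setsBetween]

theorem card_setsBetween {N s : ℕ} {A B : Finset (Fin N)} (hAB : Disjoint A B)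
    (hA : A.card ≤ s) :
    (setsBetween s A B).card = ((A ∪ B)ᶜ.card).choose (s - A.card) := by
  rw [← Finset.card_powersetCard]
  refine Finset.card_nbij' (· \ A) (· ∪ A) ?_ ?_ ?_ ?_
  · intro R hR
    obtain ⟨h1, h2, h3⟩ := mem_setsBetween.1 hR
    simp only [mem_coe, mem_powersetCard]
    refine ⟨fun x hx => ?_, by rw [card_sdiff_of_subset h2, h1]⟩
    have := Finset.disjoint_left.1 h3
    simp only [mem_sdiff, mem_compl, mem_union] at hx ⊢
    have := this hx.1
    tauto
  · intro R hR
    simp only [mem_coe, mem_powersetCard] at hR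
    have hd : Disjoint R A := Finset.disjoint_left.2 fun x hx hxA => by
      have := hR.1 hx
      simp_all
    refine mem_setsBetween.2 ⟨?_, subset_union_right, ?_⟩
    · rw [card_union_of_disjoint hd, hR.2]
      omega
    · refine Finset.disjoint_union_left.2 ⟨Finset.disjoint_left.2 fun x hx hxB => ?_, hAB⟩
      have := hR.1 hx
      simp_all
  · intro R hR
    exact Finset.sdiff_union_of_subset (mem_setsBetween.1 hR).2.1
  · intro R hR
    simp only [mem_coe, mem_powersetCard] at hR
    refine Finset.union_sdiff_cancel_right (Finset.disjoint_left.2 fun x hx hxA => ?_)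
    have := hR.1 hx
    simp_all

/-- By symmetry, a random compatible support contains a given untouched element with probability `(s
- #A) / #(A ∪ B)ᶜ`. -/
theorem card_mul_card_setsBetween_insert {N s : ℕ} {A B : Finset (Fin N)} (hAB : Disjoint A B)
    (hA : A.card < s) {x : Fin N} (hx : x ∈ (A ∪ B)ᶜ) :
    (A ∪ B)ᶜ.card * (setsBetween s (insert x A) B).card =
      (s - A.card) * (setsBetween s A B).card := by
  have hx' := hx
  simp only [mem_compl, mem_union, not_or] at hx'
  have hc : (insert x A).card = A.card + 1 := card_insert_of_notMem hx'.1
  rw [card_setsBetween hAB hA.le, card_setsBetween (by simp [hAB, hx'.2]) (by omega), hc]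
  have h1 : (insert x A ∪ B)ᶜ = (A ∪ B)ᶜ.erase x := by
    ext y; simp; try tauto
  rw [h1, card_erase_of_mem hx]
  obtain ⟨n, hn⟩ : ∃ n, (A ∪ B)ᶜ.card = n + 1 :=
    Nat.exists_eq_succ_of_ne_zero (card_ne_zero_of_mem hx)
  obtain ⟨k, hk⟩ : ∃ k, s - A.card = k + 1 := Nat.exists_eq_succ_of_ne_zero (by omega)
  rw [hn, hk, show s - (A.card + 1) = k by omega, Nat.add_sub_cancel, Nat.add_one_mul_choose_eq,
    mul_comm]

theorem setsBetween_subset_union {N s : ℕ} (A B Q : Finset (Fin N)) :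
    setsBetween s A B ⊆ setsBetween s A (B ∪ Q) ∪ Q.biUnion fun y => setsBetween s (insert y A) B := by
  intro R hR
  obtain ⟨h1, h2, h3⟩ := mem_setsBetween.1 hR
  rw [mem_union, mem_biUnion]
  by_cases h : Disjoint R Q
  · exact Or.inl (mem_setsBetween.2 ⟨h1, h2, disjoint_union_right.2 ⟨h3, h⟩⟩)
  · obtain ⟨y, hy, hyQ⟩ := Finset.not_disjoint_iff.1 h
    exact Or.inr ⟨y, hyQ, mem_setsBetween.2 ⟨h1, insert_subset hy h2, h3⟩⟩

/-- Union bound: a random compatible support meets `Q` with probability at most `2 * s / #(A ∪ B)ᶜ`.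
-/
theorem card_setsBetween_le_of_card_le_two {N s : ℕ} {A B Q : Finset (Fin N)}
    (hAB : Disjoint A B) (hA : A.card < s) (hQ : Q ⊆ (A ∪ B)ᶜ) (hQ2 : Q.card ≤ 2) :
    (A ∪ B)ᶜ.card * (setsBetween s A B).card ≤
      (A ∪ B)ᶜ.card * (setsBetween s A (B ∪ Q)).card + 2 * s * (setsBetween s A B).card := by
  calc (A ∪ B)ᶜ.card * (setsBetween s A B).card
      ≤ (A ∪ B)ᶜ.card * ((setsBetween s A (B ∪ Q)).card +
          ∑ y ∈ Q, (setsBetween s (insert y A) B).card) := by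
        gcongr
        exact (card_le_card (setsBetween_subset_union A B Q)).trans
          ((card_union_le _ _).trans (by gcongr; exact card_biUnion_le))
    _ = (A ∪ B)ᶜ.card * (setsBetween s A (B ∪ Q)).card +
          Q.card * ((s - A.card) * (setsBetween s A B).card) := by
        rw [mul_add, mul_sum, sum_congr rfl fun y hy =>
          card_mul_card_setsBetween_insert hAB hA (hQ hy), sum_const, smul_eq_mul]
    _ ≤ _ := by
        rw [mul_assoc 2]
        gcongr
        omega

/-! ### The ideal run and the runs on uniform distributions -/

namespace PCondTester

/-- The algorithm run with answers that depend on no distribution: samples are fresh uniformly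
random elements, pair queries are answered as if the support consisted of the elements sampled
earlier. Here `A` holds the elements sampled, `B` the other elements that have been queried. -/
noncomputable def idealRun {N : ℕ} : PCondTester N → Finset (Fin N) → Finset (Fin N) → PMF Bool
  | output b, _, _ => PMF.pure b
  | coin μ next, A, B => μ.bind fun i => idealRun (next i) A B
  | query S _ next, A, B =>
    if S = univ then
      (uniformAnswer (A ∪ B)ᶜ).bind fun a => idealRun (next a) (a.elim A (insert · A)) B
    else (uniformAnswer (S ∩ A)).bind fun a => idealRun (next a) A (B ∪ (S \ A))

/-- The distribution of the answer when the oracle belongs to the uniform distribution on `R`. -/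
noncomputable def uniformRun {N : ℕ} (T : PCondTester N) (R : Finset (Fin N)) (b : Bool) : ENNReal :=
  if h : R.Nonempty then T.run (PMF.uniformOfFinset R h) b else 0

end PCondTester

theorem inter_eq_inter_of_disjoint_sdiff {α : Type*} [DecidableEq α] {A B R S : Finset α}
    (hA : A ⊆ R) (hB : Disjoint R (B ∪ (S \ A))) : S ∩ R = S ∩ A := by
  ext x
  have h1 : x ∈ A → x ∈ R := fun h => hA h
  have h2 : x ∈ R → x ∉ B ∪ S \ A := fun h => Finset.disjoint_left.1 hB h
  simp only [mem_union, mem_sdiff, mem_inter] at *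
  tauto

namespace PCondTester

theorem uniformRun_output {N : ℕ} {R : Finset (Fin N)} (hR : R.Nonempty) (b b' : Bool) :
    (output b).uniformRun R b' = PMF.pure b b' := by
  rw [uniformRun, dif_pos hR, run]

theorem uniformRun_coin {N : ℕ} {R : Finset (Fin N)} (hR : R.Nonempty) (μ : PMF ℕ)
    (next : ℕ → PCondTester N) (b : Bool) :
    (coin μ next).uniformRun R b = ∑' i, μ i * (next i).uniformRun R b := by
  simp only [uniformRun, dif_pos hR, run, PMF.bind_apply]

theorem uniformRun_query {N : ℕ} {R : Finset (Fin N)} (hR : R.Nonempty) (S : Finset (Fin N)) (hS)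
    (next : Option (Fin N) → PCondTester N) (b : Bool) :
    (query S hS next).uniformRun R b =
      ∑' a, uniformAnswer (S ∩ R) a * (next a).uniformRun R b := by
  simp only [uniformRun, dif_pos hR, run, PMF.bind_apply, condOracle_uniformOfFinset]

theorem uniformRun_query_univ {N : ℕ} {R : Finset (Fin N)} (hR : R.Nonempty) (hS)
    (next : Option (Fin N) → PCondTester N) (b : Bool) :
    (query univ hS next).uniformRun R b =
      (R.card : ENNReal)⁻¹ * ∑ x ∈ R, (next (some x)).uniformRun R b := by
  simp only [uniformRun, dif_pos hR, run, condOracle_uniformOfFinset, univ_inter]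
  rw [uniformAnswer_bind_apply R hR]

/-! ### Comparison of real and ideal runs -/

/-- On the uniform distributions on the sets in `setsBetween s A B`, at most `q` queries are made. -/
def MakesAtMostBetween {N : ℕ} (s : ℕ) (A B : Finset (Fin N)) (T : PCondTester N) (q : ℕ) : Prop :=
  ∀ R ∈ setsBetween s A B, ∀ h : R.Nonempty, T.MakesAtMost (PMF.uniformOfFinset R h) q

/-- The ideal run is a lower bound, up to a small error, for the success probability averaged over
the uniform distributions on the sets in `setsBetween s A B`. -/
def IdealBound {N : ℕ} (s : ℕ) (b : Bool) (A B : Finset (Fin N)) (e : ENNReal)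
    (T : PCondTester N) : Prop :=
  ((setsBetween s A B).card : ENNReal) * T.idealRun A B b ≤
    ∑ R ∈ setsBetween s A B, T.uniformRun R b + (setsBetween s A B).card * e

/-- Serves both coins and pair queries: once the next branch has a law `μ` common to all compatible
supports, the bound passes to the average. -/
theorem tsum_idealBound {α : Type*} {N s : ℕ} {b : Bool} {A B : Finset (Fin N)} {e : ENNReal}
    (μ : PMF α) (next : α → PCondTester N)
    (h : ∀ a ∈ μ.support, IdealBound s b A B e (next a)) :
    ((setsBetween s A B).card : ENNReal) * ∑' a, μ a * (next a).idealRun A B b ≤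
      ∑ R ∈ setsBetween s A B, ∑' a, μ a * (next a).uniformRun R b +
        (setsBetween s A B).card * e := by
  calc ((setsBetween s A B).card : ENNReal) * ∑' a, μ a * (next a).idealRun A B b
      = ∑' a, μ a * ((setsBetween s A B).card * (next a).idealRun A B b) := by
        rw [← ENNReal.tsum_mul_left]
        exact tsum_congr fun a => by ring
    _ ≤ ∑' a, μ a * (∑ R ∈ setsBetween s A B, (next a).uniformRun R b +
          (setsBetween s A B).card * e) := by
        refine ENNReal.tsum_le_tsum fun a => ?_
        by_cases ha : a ∈ μ.support
        · gcongr
          exact h a ha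
        · rw [(PMF.apply_eq_zero_iff μ a).2 ha, zero_mul, zero_mul]
    _ = _ := by
        simp only [mul_add, ENNReal.tsum_add, ENNReal.tsum_mul_right, μ.tsum_coe, one_mul]
        congr 1
        simp only [mul_sum]
        exact Summable.tsum_finsetSum fun _ _ => ENNReal.summable

/-- Double counting of pairs `x ∈ R`; the inequality discards resampled `x ∈ A` on the right. -/
theorem sum_setsBetween_comm {N s : ℕ} (A B : Finset (Fin N))
    (f : Fin N → Finset (Fin N) → ENNReal) :
    ∑ x ∈ (A ∪ B)ᶜ, ∑ R ∈ setsBetween s (insert x A) B, f x R ≤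
      ∑ R ∈ setsBetween s A B, ∑ x ∈ R, f x R := by
  calc _ ≤ ∑ x, ∑ R ∈ setsBetween s (insert x A) B, f x R :=
        sum_le_sum_of_subset (subset_univ _)
    _ = _ := by
        refine Finset.sum_comm' fun x R => ?_
        simp only [mem_univ, mem_setsBetween, insert_subset_iff]
        tauto

/-- Given that the sample is new, the pair of sample and support has the same law as in the ideal
run. The loss `δ` pays for a collision, of probability `#A / s ≤ m / s`. -/
theorem idealBound_query_univ {N s m : ℕ} {δ e : ENNReal} {b : Bool} (h1 : (m : ENNReal) ≤ s * δ)
    {A B : Finset (Fin N)} (hAB : Disjoint A B) (hA : A.card ≤ m) (hAs : A.card < s)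
    (hne : ((A ∪ B)ᶜ).Nonempty) (hS) (next : Option (Fin N) → PCondTester N)
    (ih : ∀ x ∈ (A ∪ B)ᶜ, IdealBound s b (insert x A) B e (next (some x))) :
    IdealBound s b A B (e + δ) (query univ hS next) := by
  unfold IdealBound at *
  set n : ENNReal := ((A ∪ B)ᶜ.card : ENNReal) with hn
  set C : ENNReal := ((setsBetween s A B).card : ENNReal) with hC
  have hn0 : n ≠ 0 := by simpa [hn, ← compl_union] using hne.ne_empty
  have hnt : n ≠ ⊤ := by simp [hn]
  have hs0 : (s : ENNReal) ≠ 0 := by simp; omega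
  have hst : (s : ENNReal) ≠ ⊤ := by simp
  set k : ENNReal := ((s - A.card : ℕ) : ENNReal) with hk
  have hks : k + A.card = s := by
    rw [hk, ← Nat.cast_add]; congr 1; omega
  have hCx : ∀ x ∈ (A ∪ B)ᶜ, ((setsBetween s (insert x A) B).card : ENNReal) = n⁻¹ * (k * C) := by
    intro x hx
    have := card_mul_card_setsBetween_insert hAB hAs hx
    rw [hk, hC, ← Nat.cast_mul, ← this, Nat.cast_mul, ← mul_assoc, ENNReal.inv_mul_cancel hn0 hnt,
      one_mul]
  have hid : (query univ hS next).idealRun A B b =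
      n⁻¹ * ∑ x ∈ (A ∪ B)ᶜ, (next (some x)).idealRun (insert x A) B b := by
    rw [idealRun, if_pos rfl, uniformAnswer_bind_apply _ hne]
    rfl
  set I := (query univ hS next).idealRun A B b with hI
  have hI1 : I ≤ 1 := PMF.coe_le_one _ _
  have hF : ∑ R ∈ setsBetween s A B, (query univ hS next).uniformRun R b =
      (s : ENNReal)⁻¹ * ∑ R ∈ setsBetween s A B, ∑ x ∈ R, (next (some x)).uniformRun R b := by
    rw [mul_sum]
    refine sum_congr rfl fun R hR => ?_
    have hc := (mem_setsBetween.1 hR).1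
    rw [uniformRun_query_univ (card_pos.1 (by omega)), hc]
  set F := ∑ R ∈ setsBetween s A B, (query univ hS next).uniformRun R b with hFdef
  -- `k / s` is the probability of a new sample; only this part of the ideal run is matched here.
  have hmain : k * (C * I) ≤ s * (F + C * e) := by
    calc k * (C * I) = ∑ x ∈ (A ∪ B)ᶜ, n⁻¹ * (k * C) *
            (next (some x)).idealRun (insert x A) B b := by
          rw [← mul_sum, hid]; ring
      _ ≤ ∑ x ∈ (A ∪ B)ᶜ, (∑ R ∈ setsBetween s (insert x A) B, (next (some x)).uniformRun R b +
            n⁻¹ * (k * C) * e) := by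
          refine sum_le_sum fun x hx => ?_
          have := ih x hx
          rwa [hCx x hx] at this
      _ ≤ s * F + k * (C * e) := by
          rw [sum_add_distrib, sum_const, nsmul_eq_mul, hF, ← mul_assoc (s : ENNReal),
            ENNReal.mul_inv_cancel hs0 hst, one_mul]
          refine add_le_add (sum_setsBetween_comm A B _) (le_of_eq ?_)
          rw [← mul_assoc, ← mul_assoc, ENNReal.mul_inv_cancel hn0 hnt, one_mul, mul_assoc]
      _ ≤ s * (F + C * e) := by
          rw [mul_add]
          gcongr
          rw [← hks]
          exact le_self_add
  refine (ENNReal.mul_le_mul_iff_right hs0 hst).1 ?_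
  calc (s : ENNReal) * (C * I) = k * (C * I) + A.card * (C * I) := by rw [← hks]; ring
    _ ≤ s * (F + C * e) + s * δ * (C * 1) := by
        gcongr
        exact le_trans (by exact_mod_cast hA) h1
    _ = _ := by ring

/-- Unless the support meets `S \ A` outside `B`, the true answer has the ideal law. The loss `δ`
pays for the supports that do. -/
theorem idealBound_query_pair {N s m : ℕ} {δ e : ENNReal} {b : Bool}
    (h2 : 2 * (s : ENNReal) ≤ (N - 3 * m : ℕ) * δ) (hN : 3 * m < N)
    {A B S : Finset (Fin N)} (hAB : Disjoint A B) (hcard : A.card + B.card ≤ 3 * m)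
    (hAs : A.card < s) (hS) (hSu : S ≠ univ) (hS2 : S.card = 2)
    (next : Option (Fin N) → PCondTester N)
    (ih : ∀ a ∈ (uniformAnswer (S ∩ A)).support, IdealBound s b A (B ∪ (S \ A)) e (next a)) :
    IdealBound s b A B (e + δ) (query S hS next) := by
  have hB' : B ∪ (S \ (A ∪ B)) = B ∪ (S \ A) := by
    ext; simp; tauto
  have hQ := card_setsBetween_le_of_card_le_two (s := s) (Q := S \ (A ∪ B)) hAB hAs
    (fun x hx => by simp_all) ((card_le_card sdiff_subset).trans hS2.le)
  rw [hB'] at hQ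
  have hn : N - 3 * m ≤ (A ∪ B)ᶜ.card := by
    have := card_union_le A B
    rw [card_compl, Fintype.card_fin]
    omega
  have hmain := tsum_idealBound _ next ih
  unfold IdealBound at *
  set n : ENNReal := ((A ∪ B)ᶜ.card : ENNReal) with hndef
  set C : ENNReal := ((setsBetween s A B).card : ENNReal) with hC
  set C' : ENNReal := ((setsBetween s A (B ∪ (S \ A))).card : ENNReal) with hC'
  have hn0 : n ≠ 0 := by
    simp only [hndef, ne_eq, Nat.cast_eq_zero]
    omega
  have hnt : n ≠ ⊤ := ENNReal.natCast_ne_top _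
  have hsub : setsBetween s A (B ∪ (S \ A)) ⊆ setsBetween s A B := fun R hR => by
    obtain ⟨h, h', h''⟩ := mem_setsBetween.1 hR
    exact mem_setsBetween.2 ⟨h, h', (disjoint_union_right.1 h'').1⟩
  have hCC' : C ≤ C' + C * δ := by
    refine (ENNReal.mul_le_mul_iff_right hn0 hnt).1 ?_
    calc n * C ≤ n * C' + 2 * s * C := by rw [hndef, hC, hC']; exact_mod_cast hQ
      _ ≤ n * C' + n * δ * C := by
          refine add_le_add le_rfl (mul_le_mul_left (h2.trans ?_) C)
          exact mul_le_mul_left (Nat.cast_le.2 hn) δ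
      _ = n * (C' + C * δ) := by ring
  have hid : (query S hS next).idealRun A B b =
      ∑' a, uniformAnswer (S ∩ A) a * (next a).idealRun A (B ∪ (S \ A)) b := by
    rw [idealRun, if_neg hSu, PMF.bind_apply]
  have hF : ∑ R ∈ setsBetween s A (B ∪ (S \ A)),
      ∑' a, uniformAnswer (S ∩ A) a * (next a).uniformRun R b ≤
      ∑ R ∈ setsBetween s A B, (query S hS next).uniformRun R b := by
    refine le_trans (le_of_eq (sum_congr rfl fun R hR => ?_)) (sum_le_sum_of_subset hsub)
    obtain ⟨h, h', h''⟩ := mem_setsBetween.1 hR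
    rw [uniformRun_query (card_pos.1 (by omega)), inter_eq_inter_of_disjoint_sdiff h' h'']
  rw [← hid] at hmain
  set I := (query S hS next).idealRun A B b with hI
  have hI1 : I ≤ 1 := PMF.coe_le_one _ _
  calc C * I ≤ (C' + C * δ) * I := by gcongr
    _ = C' * I + C * δ * I := by ring
    _ ≤ (∑ R ∈ setsBetween s A B, (query S hS next).uniformRun R b + C * e) + C * δ * 1 := by
        gcongr
        refine hmain.trans (add_le_add hF ?_)
        gcongr
        exact Nat.cast_le.2 (card_le_card hsub)
    _ = _ := by ring

/-- The budgets on `A` and `B` are preserved since a sample adds one element to `A` and a pair at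
most two to `B`; they keep `#A + #B ≤ 3 * m`. -/
theorem idealBound {N s m : ℕ} {δ : ENNReal} (b : Bool) (hs : 0 < s) (hms : m ≤ s)
    (h1 : (m : ENNReal) ≤ s * δ) (h2 : 2 * (s : ENNReal) ≤ (N - 3 * m : ℕ) * δ) (hN : 3 * m < N)
    (T : PCondTester N) (A B : Finset (Fin N)) (q : ℕ) (hAB : Disjoint A B)
    (hA : A.card + q ≤ m) (hB : B.card + 2 * q ≤ 2 * m) (hT : T.MakesAtMostBetween s A B q) :
    IdealBound s b A B (q * δ) T := by
  have hne : ∀ A B : Finset (Fin N), ∀ R ∈ setsBetween s A B, R.Nonempty := fun A B R hR => by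
    rw [← card_pos, (mem_setsBetween.1 hR).1]
    exact hs
  induction T generalizing A B q with
  | output b' =>
    refine le_trans (le_of_eq ?_) le_self_add
    rw [sum_congr rfl fun R hR => uniformRun_output (hne A B R hR) b' b, sum_const, nsmul_eq_mul,
      idealRun]
  | coin μ next ih =>
    have := tsum_idealBound μ next fun i hi => ih i A B q hAB hA hB fun R hR h => by
      have := hT R hR h
      rw [MakesAtMost] at this
      exact this i hi
    rw [IdealBound, idealRun, PMF.bind_apply, sum_congr rfl fun R hR =>
      uniformRun_coin (hne A B R hR) μ next b]
    exact this
  | query S hS next ih =>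
    by_cases hemp : setsBetween s A B = ∅
    · simp [IdealBound, hemp]
    -- The query bound says something only if a compatible support exists; such a support excludes
    -- `q = 0`.
    obtain ⟨q, rfl⟩ : ∃ q', q = q' + 1 := by
      obtain ⟨R, hR⟩ := nonempty_iff_ne_empty.2 hemp
      have := hT R hR (hne A B R hR)
      cases q with
      | zero => exact absurd this (by rw [MakesAtMost]; exact id)
      | succ q => exact ⟨q, rfl⟩
    have hnext : ∀ R ∈ setsBetween s A B, ∀ h : R.Nonempty, ∀ a ∈ (uniformAnswer (S ∩ R)).support,
        (next a).MakesAtMost (PMF.uniformOfFinset R h) q := fun R hR h => by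
      have := hT R hR h
      rwa [MakesAtMost, condOracle_uniformOfFinset] at this
    rw [Nat.cast_add, Nat.cast_one, add_mul, one_mul]
    by_cases hSu : S = univ
    · subst hSu
      refine idealBound_query_univ h1 hAB (by omega) (by omega) ?_ hS next fun x hx => ?_
      · have := card_union_le A B
        rw [← card_pos, card_compl, Fintype.card_fin]
        omega
      · simp only [mem_compl, mem_union, not_or] at hx
        refine ih _ _ _ _ (by simp [hAB, hx.2]) ?_ (by omega) fun R hR h => ?_
        · rw [card_insert_of_notMem hx.1]
          omega
        · obtain ⟨h, h', h''⟩ := mem_setsBetween.1 hR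
          rw [insert_subset_iff] at h'
          exact hnext R (mem_setsBetween.2 ⟨h, h'.2, h''⟩) _ _
            (some_mem_support_uniformAnswer (by simpa using h'.1))
    · have hS2 : S.card = 2 := hS.resolve_right fun h =>
        hSu ((card_eq_iff_eq_univ S).1 (by simpa using h))
      refine idealBound_query_pair h2 hN hAB (by omega) (by omega) hS hSu hS2 next fun a ha => ?_
      refine ih _ _ _ _ ?_ (by omega) ?_ fun R hR h => ?_
      · exact disjoint_union_right.2 ⟨hAB, disjoint_sdiff⟩
      · have h3 := card_union_le B (S \ A)
        have h4 := card_le_card (sdiff_subset (s := S) (t := A))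
        omega
      · obtain ⟨h, h', h''⟩ := mem_setsBetween.1 hR
        refine hnext R (mem_setsBetween.2 ⟨h, h', (disjoint_union_right.1 h'').1⟩) _ a ?_
        rwa [inter_eq_inter_of_disjoint_sdiff h' h'']

end PCondTester

/-! ### Flat distributions and total variation distance -/

theorem uniformOfFinset_mem_flatWithSupportSize {N : ℕ} {R : Finset (Fin N)} (hR : R.Nonempty) :
    PMF.uniformOfFinset R hR ∈ flatWithSupportSize N R.card := by
  refine ⟨by rw [PMF.support_uniformOfFinset, Set.ncard_coe_finset], fun x hx y hy => ?_⟩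
  rw [PMF.mem_support_uniformOfFinset_iff] at hx hy
  rw [PMF.uniformOfFinset_apply_of_mem hR hx, PMF.uniformOfFinset_apply_of_mem hR hy]

theorem labelInvariant_flatWithSupportSize (N s : ℕ) :
    LabelInvariant (flatWithSupportSize N s) := by
  rintro D ⟨hs, hD⟩ π
  have happ : ∀ x, D.map π (π x) = D x := fun x => by
    rw [PMF.map_apply, tsum_eq_single x]
    · simp
    · intro y hy
      simp [hy.symm]
  refine ⟨by rw [PMF.support_map, Set.ncard_image_of_injective _ π.injective, hs], ?_⟩
  rw [IsFlat, PMF.support_map]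
  rintro _ ⟨x, hx, rfl⟩ _ ⟨y, hy, rfl⟩
  rw [happ, happ, hD x hx y hy]

theorem sum_toReal_eq_one {α : Type*} [Fintype α] (D : PMF α) : ∑ x, (D x).toReal = 1 := by
  have h := D.tsum_coe
  rw [tsum_fintype] at h
  rw [← ENNReal.toReal_sum fun x _ => D.apply_ne_top x, h, ENNReal.toReal_one]

theorem toReal_bool_add {p : PMF Bool} : (p true).toReal + (p false).toReal = 1 := by
  rw [← Fintype.sum_bool fun b => (p b).toReal, sum_toReal_eq_one]

theorem toReal_le_inv_of_mem_flatWithSupportSize {N s : ℕ} {D : PMF (Fin N)}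
    (hD : D ∈ flatWithSupportSize N s) (x : Fin N) : (D x).toReal ≤ (s : ℝ)⁻¹ := by
  classical
  obtain ⟨hs, hflat⟩ := hD
  by_cases hx : x ∈ D.support
  · have hcard : #{y | y ∈ D.support} = s := by
      rw [← hs, ← Set.ncard_coe_finset]
      congr 1
      ext y
      simp
    have hs0 : 0 < s := by
      rw [← hcard]
      exact card_pos.2 ⟨x, by simpa using hx⟩
    have : (s : ℝ) * (D x).toReal ≤ 1 := by
      calc (s : ℝ) * (D x).toReal = ∑ y with y ∈ D.support, (D y).toReal := by
            rw [← hcard, ← nsmul_eq_mul, ← sum_const]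
            exact sum_congr rfl fun y hy => by rw [hflat x hx y (mem_filter.1 hy).2]
        _ ≤ ∑ y, (D y).toReal :=
            sum_le_univ_sum_of_nonneg fun _ => ENNReal.toReal_nonneg
        _ = 1 := sum_toReal_eq_one D
    rw [← one_div, le_div_iff₀' (by exact_mod_cast hs0)]
    exact this
  · rw [(PMF.apply_eq_zero_iff D x).2 hx]
    simp

/-- The mass of `D` outside the support of `D'` bounds the distance from below. -/
theorem one_sub_ncard_support_mul_le_tvDist {N : ℕ} (D D' : PMF (Fin N)) {p : ℝ}
    (hp : ∀ x, (D x).toReal ≤ p) : 1 - D'.support.ncard * p ≤ tvDist D D' := by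
  classical
  set W : Finset (Fin N) := {y | y ∈ D'.support} with hW
  have hcard : #W = D'.support.ncard := by
    rw [← Set.ncard_coe_finset]
    congr 1
    ext y
    simp [hW]
  have hDW : ∑ x ∈ W, (D x).toReal ≤ D'.support.ncard * p := by
    rw [← hcard, ← nsmul_eq_mul]
    exact sum_le_card_nsmul _ _ _ fun x _ => hp x
  have hout : ∀ x ∈ Wᶜ, (D' x).toReal = 0 := fun x hx => by
    have : x ∉ D'.support := by simpa [hW] using hx
    rw [(PMF.apply_eq_zero_iff D' x).2 this, ENNReal.toReal_zero]
  have h1 := sum_toReal_eq_one D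
  have h2 := sum_toReal_eq_one D'
  rw [← sum_add_sum_compl W] at h1 h2
  rw [sum_eq_zero hout] at h2
  have h3 : ∑ x ∈ W, ((D' x).toReal - (D x).toReal) ≤ ∑ x ∈ W, |(D x).toReal - (D' x).toReal| :=
    sum_le_sum fun x _ => by rw [abs_sub_comm]; exact le_abs_self _
  have h4 : ∑ x ∈ Wᶜ, (D x).toReal ≤ ∑ x ∈ Wᶜ, |(D x).toReal - (D' x).toReal| :=
    sum_le_sum fun x hx => by rw [hout x hx, sub_zero]; exact le_abs_self _
  rw [sum_sub_distrib] at h3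
  rw [tvDist, ← sum_add_sum_compl W]
  linarith

theorem half_lt_tvDistTo_flatWithSupportSize {N s s' : ℕ} {D : PMF (Fin N)}
    (hD : D ∈ flatWithSupportSize N s) (hss : 2 * s' < s)
    (hne : (flatWithSupportSize N s').Nonempty) :
    1 / 2 < tvDistTo D (flatWithSupportSize N s') := by
  have hs : (0 : ℝ) < s := by exact_mod_cast (by omega : 0 < s)
  have hlt : (1 / 2 : ℝ) < 1 - s' * (s : ℝ)⁻¹ := by
    have : (s' : ℝ) * (s : ℝ)⁻¹ < 1 / 2 := by
      rw [← div_eq_mul_inv, div_lt_iff₀ hs]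
      have : (2 * s' : ℝ) < s := by exact_mod_cast hss
      linarith
    linarith
  -- Nonemptiness matters: the real `sInf` of the empty set is `0`.
  refine hlt.trans_le (le_csInf (hne.image _) ?_)
  rintro _ ⟨D', hD', rfl⟩
  have := one_sub_ncard_support_mul_le_tvDist D D' (toReal_le_inv_of_mem_flatWithSupportSize hD)
  rwa [hD'.1] at this

theorem flatWithSupportSize_nonempty {N s : ℕ} (hs : 0 < s) (hsN : s ≤ N) :
    (flatWithSupportSize N s).Nonempty := by
  obtain ⟨R, -, hR⟩ := exists_subset_card_eq (s := (univ : Finset (Fin N))) (n := s) (by simpa)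
  subst hR
  exact ⟨_, uniformOfFinset_mem_flatWithSupportSize (card_pos.1 hs)⟩

/-! ### Indistinguishability of two support sizes -/

namespace PCondTester

theorem toReal_idealRun_le {N s m q : ℕ} (hm : 0 < m) (hqm : q ≤ m) (hs : 3 * m * m ≤ s)
    (hsN : 6 * s * m + 3 * m ≤ N) (T : PCondTester N) (b : Bool) {ε : ℝ} (hε : 0 ≤ ε)
    (hT : ∀ D ∈ flatWithSupportSize N s, (T.run D b).toReal ≤ ε)
    (hq : ∀ D ∈ flatWithSupportSize N s, T.MakesAtMost D q) :
    (T.idealRun ∅ ∅ b).toReal ≤ ε + 1 / 3 := by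
  have hs0 : 0 < s := by nlinarith
  have hms : m ≤ s := by nlinarith
  have hsm : 0 < s * m := Nat.mul_pos hs0 hm
  have hsm' : s ≤ s * m := Nat.le_mul_of_pos_right _ hm
  have h30 : ((3 * m : ℕ) : ENNReal) ≠ 0 := by
    rw [Nat.cast_ne_zero]; omega
  have h3t : ((3 * m : ℕ) : ENNReal) ≠ ⊤ := ENNReal.natCast_ne_top _
  -- With `δ = 1 / (3 * m)`, the `q ≤ m` queries lose at most `1 / 3` in total.
  have hbound := idealBound (N := N) (δ := ((3 * m : ℕ) : ENNReal)⁻¹) b hs0 hms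
    (by
      rw [← div_eq_mul_inv, ENNReal.le_div_iff_mul_le (Or.inl h30) (Or.inl h3t)]
      exact_mod_cast (by nlinarith : m * (3 * m) ≤ s))
    (by
      rw [← div_eq_mul_inv, ENNReal.le_div_iff_mul_le (Or.inl h30) (Or.inl h3t)]
      have : 2 * s * (3 * m) ≤ N - 3 * m := by
        have : 2 * s * (3 * m) = 6 * s * m := by ring
        omega
      exact_mod_cast this)
    (by rw [mul_assoc] at hsN; omega) T ∅ ∅ q (disjoint_empty_left _) (by simpa) (by simpa)
    (fun R hR h => hq _ ((mem_setsBetween.1 hR).1 ▸ uniformOfFinset_mem_flatWithSupportSize h))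
  unfold IdealBound at hbound
  set C : ENNReal := ((setsBetween s (∅ : Finset (Fin N)) ∅).card : ENNReal) with hC
  have hC0 : C ≠ 0 := by
    rw [hC, Nat.cast_ne_zero, card_setsBetween (disjoint_empty_left _) (by simp)]
    refine (Nat.choose_pos ?_).ne'
    simp only [card_empty, union_idempotent, compl_empty, card_univ, Fintype.card_fin]
    rw [mul_assoc] at hsN
    omega
  have hsum : ∑ R ∈ setsBetween s (∅ : Finset (Fin N)) ∅, T.uniformRun R b ≤
      C * ENNReal.ofReal ε := by
    rw [hC, ← nsmul_eq_mul]
    refine sum_le_card_nsmul _ _ _ fun R hR => ?_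
    have hc := (mem_setsBetween.1 hR).1
    have hne : R.Nonempty := card_pos.1 (by omega)
    rw [uniformRun, dif_pos hne]
    exact (ENNReal.le_ofReal_iff_toReal_le (PMF.apply_ne_top _ _) hε).2
      (hT _ (hc ▸ uniformOfFinset_mem_flatWithSupportSize hne))
  have hqδ : (q : ENNReal) * ((3 * m : ℕ) : ENNReal)⁻¹ ≤ ENNReal.ofReal (1 / 3) := by
    rw [← div_eq_mul_inv, ENNReal.div_le_iff h30 h3t, ← ENNReal.ofReal_natCast (3 * m),
      ← ENNReal.ofReal_mul (by norm_num), ← ENNReal.ofReal_natCast q]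
    refine ENNReal.ofReal_le_ofReal ?_
    have : (q : ℝ) ≤ m := by exact_mod_cast hqm
    push_cast
    linarith
  rw [← ENNReal.le_ofReal_iff_toReal_le (PMF.apply_ne_top _ _) (by positivity),
    ENNReal.ofReal_add hε (by norm_num)]
  refine (ENNReal.mul_le_mul_iff_right hC0 (ENNReal.natCast_ne_top _)).1 ?_
  rw [mul_add]
  refine hbound.trans ?_
  gcongr

/-- Few queries do not tell apart flat distributions with support sizes `s` and `s'`. -/
theorem not_isPromiseTester_flatWithSupportSize {N s s' m q : ℕ} (hm : 0 < m) (hqm : q ≤ m)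
    (hs : 3 * m * m ≤ s) (hss : s ≤ s') (hsN : 6 * s' * m + 3 * m ≤ N) (T : PCondTester N)
    (hq : ∀ D ∈ flatWithSupportSize N s ∪ flatWithSupportSize N s', T.MakesAtMost D q) :
    ¬ IsPromiseTester T (flatWithSupportSize N s) (flatWithSupportSize N s') 0.01 := by
  rintro ⟨hyes, hno⟩
  have h1 := toReal_idealRun_le hm hqm hs (le_trans (by gcongr) hsN) T false (ε := 0.01)
    (by norm_num) (fun D hD => by
      have := hyes D hD
      have := toReal_bool_add (p := T.run D)
      linarith) fun D hD => hq D (Or.inl hD)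
  have h2 := toReal_idealRun_le hm hqm (hs.trans hss) hsN T true (ε := 0.01)
    (by norm_num) (fun D hD => by
      have := hno D hD
      have := toReal_bool_add (p := T.run D)
      linarith) fun D hD => hq D (Or.inr hD)
  -- The two answers of the ideal run would have total probability at most `0.02 + 2 / 3 < 1`.
  have := toReal_bool_add (p := T.idealRun ∅ ∅)
  norm_num at h1 h2
  linarith

end PCondTester

/-! ### Choice of parameters -/

theorem le_rpow_one_third_of_pow_three_le {a x : ℝ} (ha : 0 ≤ a) (h : a ^ 3 ≤ x) :
    a ≤ x ^ (1 / 3 : ℝ) := by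
  calc a = (a ^ 3) ^ (1 / 3 : ℝ) := by
        rw [← Real.rpow_natCast, ← Real.rpow_mul ha]; norm_num
    _ ≤ x ^ (1 / 3 : ℝ) := Real.rpow_le_rpow (by positivity) h (by norm_num)

theorem hard_isPromiseTester_query_bound {K : ℝ} (hK : 2 < K) {N : ℕ}
    (hN : 18 * K ≤ (N : ℝ) ^ (1 / 3 : ℝ)) (T : PCondTester N) (q : ℕ)
    (hT : IsPromiseTester T (hardYes K N) (hardNo N) 0.01)
    (hq : ∀ D ∈ hardYes K N ∪ hardNo N, T.MakesAtMost D q) :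
    1 / (18 * K) * (N : ℝ) ^ (1 / 3 : ℝ) ≤ q := by
  by_contra! hlt
  set t : ℝ := (N : ℝ) ^ (1 / 3 : ℝ) with ht
  have ht2 : (N : ℝ) ^ (2 / 3 : ℝ) = t ^ 2 := by
    rw [ht, ← Real.rpow_natCast, ← Real.rpow_mul (by positivity)]; norm_num
  have ht3 : (N : ℝ) = t ^ 3 := by
    rw [ht, ← Real.rpow_natCast, ← Real.rpow_mul (by positivity)]; norm_num
  have hK0 : 0 < K := by linarith
  have ht1 : 1 ≤ t := by linarith
  have hct : 1 ≤ 1 / (18 * K) * t := by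
    rw [one_div_mul_eq_div, le_div_iff₀ (by positivity)]; linarith
  have hm : ((q + 1 : ℕ) : ℝ) ≤ t / (9 * K) := by
    have : t / (9 * K) = 2 * (1 / (18 * K) * t) := by field_simp; norm_num
    push_cast
    linarith
  have hm' : ((q + 1 : ℕ) : ℝ) ≤ t / 18 := by
    refine hm.trans ?_
    gcongr
    linarith
  -- `q + 1` rather than `q` keeps `m` positive; the extra `1` is absorbed by `hct`, at the price of
  -- a factor `2` in `hm`.
  refine PCondTester.not_isPromiseTester_flatWithSupportSize (m := q + 1) (Nat.succ_pos q)
    (Nat.le_succ q) ?_ ?_ ?_ T hq hT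
  · rw [ht2]
    refine Nat.le_floor ?_
    rw [Nat.cast_mul, Nat.cast_mul]
    calc ((3 : ℕ) : ℝ) * ((q + 1 : ℕ) : ℝ) * ((q + 1 : ℕ) : ℝ)
        ≤ 3 * (t / (9 * K)) * (t / 18) := by
          rw [Nat.cast_ofNat]; gcongr
      _ = t ^ 2 / K * (1 / 54) := by field_simp; norm_num
      _ ≤ t ^ 2 / K := mul_le_of_le_one_right (by positivity) (by norm_num)
  · refine Nat.floor_le_floor (div_le_self (by positivity) (by linarith))
  · rw [ht2]
    have hfl : ((⌊t ^ 2⌋₊ : ℕ) : ℝ) ≤ t ^ 2 := Nat.floor_le (by positivity)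
    have : (6 * ((⌊t ^ 2⌋₊ : ℕ) : ℝ) * ((q + 1 : ℕ) : ℝ) + 3 * ((q + 1 : ℕ) : ℝ)) ≤ (N : ℝ) := by
      calc _ ≤ 6 * t ^ 2 * (t / 18) + 3 * (t / 18) := by gcongr
        _ ≤ t ^ 3 := by nlinarith [mul_nonneg (sub_nonneg.2 ht1) (sq_nonneg t), sq_nonneg (t - 1)]
        _ = N := ht3.symm
    exact_mod_cast this

theorem half_lt_tvDistTo_hardYes {K : ℝ} (hK : 2 < K) {N : ℕ}
    (hN : K + K / (K - 2) ≤ (N : ℝ) ^ (1 / 3 : ℝ)) {D : PMF (Fin N)} (hD : D ∈ hardNo N) :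
    1 / 2 < tvDistTo D (hardYes K N) := by
  set t : ℝ := (N : ℝ) ^ (1 / 3 : ℝ) with ht
  have ht2 : (N : ℝ) ^ (2 / 3 : ℝ) = t ^ 2 := by
    rw [ht, ← Real.rpow_natCast, ← Real.rpow_mul (by positivity)]; norm_num
  have ht3 : (N : ℝ) = t ^ 3 := by
    rw [ht, ← Real.rpow_natCast, ← Real.rpow_mul (by positivity)]; norm_num
  have hK2 : 0 < K - 2 := by linarith
  have hq : 0 < K / (K - 2) := by positivity
  have ht1 : 1 ≤ t := by linarith
  have htt : t ≤ t ^ 2 := by nlinarith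
  refine half_lt_tvDistTo_flatWithSupportSize hD ?_ (flatWithSupportSize_nonempty ?_ ?_)
  · rw [ht2]
    have h1 : ((⌊t ^ 2 / K⌋₊ : ℕ) : ℝ) ≤ t ^ 2 / K := Nat.floor_le (by positivity)
    have h2 : t ^ 2 < ⌊t ^ 2⌋₊ + 1 := Nat.lt_floor_add_one _
    -- This is `2 * t ^ 2 / K ≤ t ^ 2 - 1`: the slack `1` compensates for rounding `t ^ 2` down, and
    -- `K > 2` is essential.
    have h3 : K ≤ t ^ 2 * (K - 2) := by
      rw [← div_le_iff₀ hK2]; linarith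
    have h4 : 2 * (t ^ 2 / K) ≤ t ^ 2 - 1 := by
      rw [← mul_div_assoc, div_le_iff₀ (by linarith)]; nlinarith
    have : (2 * ((⌊t ^ 2 / K⌋₊ : ℕ) : ℝ)) < ((⌊t ^ 2⌋₊ : ℕ) : ℝ) := by linarith
    exact_mod_cast this
  · rw [ht2, Nat.floor_pos, le_div_iff₀ (by linarith)]
    linarith
  · rw [ht2]
    refine Nat.floor_le_of_le ?_
    rw [ht3]
    calc t ^ 2 / K ≤ t ^ 2 := div_le_self (by positivity) (by linarith)
      _ ≤ t ^ 3 := pow_le_pow_right₀ ht1 (by norm_num)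

theorem corollary3p5 (K : ℝ) (hK : 2 < K) :
    (∀ N : ℕ, LabelInvariant (hardYes K N) ∧ LabelInvariant (hardNo N)) ∧
    ∃ c : ℝ, 0 < c ∧ ∃ N₀ : ℕ, ∀ N : ℕ, N₀ ≤ N →
      -- the promise problem
      (∀ (T : PCondTester N) (q : ℕ),
        IsPromiseTester T (hardYes K N) (hardNo N) 0.01 →
        (∀ D ∈ hardYes K N ∪ hardNo N, T.MakesAtMost D q) →
        c * (N : ℝ) ^ (1 / 3 : ℝ) ≤ q) ∧
      -- testing the property with proximity parameter `τ`
      (∀ (τ : ℝ), 0 < τ → τ ≤ 1 / 2 → ∀ (T : PCondTester N) (q : ℕ),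
        IsPropertyTester T (hardYes K N) τ 0.01 →
        (∀ D ∈ hardYes K N ∪ hardNo N, T.MakesAtMost D q) →
        c * (N : ℝ) ^ (1 / 3 : ℝ) ≤ q) := by

  -- In `N₀`, `18 * K` serves the query bound and `K / (K - 2)` the distance between Yes and No
  -- instances.
  refine ⟨fun N => ⟨labelInvariant_flatWithSupportSize _ _, labelInvariant_flatWithSupportSize _ _⟩,
    1 / (18 * K), by positivity, ⌈(18 * K + K / (K - 2)) ^ 3⌉₊, fun N hN => ?_⟩
  have hr : 0 < K / (K - 2) := div_pos (by linarith) (by linarith)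
  have ht : 18 * K + K / (K - 2) ≤ (N : ℝ) ^ (1 / 3 : ℝ) :=
    le_rpow_one_third_of_pow_three_le (by linarith) (Nat.ceil_le.1 hN)
  refine ⟨hard_isPromiseTester_query_bound hK (by linarith), fun τ _ hτ T q hT hq => ?_⟩
  exact hard_isPromiseTester_query_bound hK (by linarith) T q ⟨hT.1, fun D hD =>
    hT.2 D (hτ.trans_lt (half_lt_tvDistTo_hardYes hK (by linarith) hD))⟩ hq
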